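/- Let $K$ be a field of characteristic zero, let $n\ge 1$ and $m\ge 2$ be integers with $n\ne 2$, let $R=K[X_1,\dots,X_n]$ and $f=X_1^2+X_2^2+\dots+X_{n-1}^2+X_n^m$. Let $H^1_{(f)}(R)=R_f/R$ be the first local cohomology module of $R$ with support in $(f)$, on which the commuting operators $\partial_i=\partial/\partial X_i$ act through the quotient rule on $R_f$, and let $H^{p}(\partial;H^1_{(f)}(R))$ denote the $p$-th de Rham cohomology of this module, i.e. the $p$-th cohomology of the Koszul cochain complex of $\partial=\partial_1,\dots,\partial_n$ on it. Then: 1. if $m$ is odd, then $H^{n-1}(\partial;H^1_{(f)}(R))=0$; 2. if $m$ is even, then (a) if $n$ is odd, $H^{n-1}(\partial;H^1_{(f)}(R))=0$; (b) if $n$ is even, $\dim_K H^{n-1}(\partial;H^1_{(f)}(R))\le 1$. -/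

import Mathlib

namespace DeRhamLocalCohomology

/-! ### The de Rham complex of commuting operators -/

/-- The index set of the standard basis `dX_S` of the `p`-forms in `n` variables: the subsets `S`
of `{0, …, n-1}` with `p` elements, `dX_S` being the wedge of the `dX_i`, `i ∈ S`, in increasing
order. -/
abbrev FormIndex (n p : ℕ) : Type := {S : Finset (Fin n) // S.card = p}

/-- The index `S \ {i}`, for `i ∈ S`. -/
def FormIndex.erase {n p : ℕ} (S : FormIndex n (p + 1)) (i : Fin n) (hi : i ∈ S.1) :
    FormIndex n p :=
  ⟨S.1.erase i, by rw [Finset.card_erase_of_mem hi, S.2, Nat.add_sub_cancel]⟩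

/-- The `p`-th differential of the de Rham complex (the Koszul cochain complex) of the operators
`D_i` on `N`, where `∑ ω_S dX_S ↦ ∑ i, ∑ S, D_i (ω_S) dX_i ∧ dX_S`. The coefficient of `dX_S` in the
image of `ω` is `∑ i ∈ S, (-1) ^ #{j ∈ S | j < i} D_i (ω_(S \ {i}))`. -/
noncomputable def deRhamD (K : Type*) [Field K] {n : ℕ} {N : Type*} [AddCommGroup N] [Module K N]
    (D : Fin n → Module.End K N) (p : ℕ) :
    (FormIndex n p → N) →ₗ[K] (FormIndex n (p + 1) → N) :=
  LinearMap.pi fun S => ∑ i : {i : Fin n // i ∈ S.1},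
    ((-1 : K) ^ (S.1.filter (fun j => j < i.1)).card) •
      (D i.1 ∘ₗ LinearMap.proj (S.erase i.1 i.2))

theorem deRhamD_apply (K : Type*) [Field K] {n : ℕ} {N : Type*} [AddCommGroup N] [Module K N]
    (D : Fin n → Module.End K N) (p : ℕ) (w : FormIndex n p → N) (S : FormIndex n (p + 1)) :
    deRhamD K D p w S = ∑ i : {i : Fin n // i ∈ S.1},
      ((-1 : K) ^ (S.1.filter (fun j => j < i.1)).card) • D i.1 (w (S.erase i.1 i.2)) := by
  simp [deRhamD, LinearMap.sum_apply]

/-- The sign rule behind `d ∘ d = 0`. -/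
theorem sign_swap (K : Type*) [Field K] {n : ℕ} (S : Finset (Fin n)) {i j : Fin n}
    (hi : i ∈ S) (hij : i < j) :
    (-1 : K) ^ (S.filter (fun k => k < i)).card *
        (-1 : K) ^ ((S.erase i).filter (fun k => k < j)).card =
      -((-1 : K) ^ (S.filter (fun k => k < j)).card *
        (-1 : K) ^ ((S.erase j).filter (fun k => k < i)).card) := by
  have h1 : (S.filter (fun k => k < j)).card =
      ((S.erase i).filter (fun k => k < j)).card + 1 := by
    rw [Finset.filter_erase, Finset.card_erase_add_one]
    simp [hi, hij]
  have h2 : (S.erase j).filter (fun k => k < i) = S.filter (fun k => k < i) := by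
    rw [Finset.filter_erase, Finset.erase_eq_of_notMem]
    simp [hij.le]
  rw [h1, h2, pow_succ]
  ring

/-- If the operators commute, `d ∘ d = 0`. -/
theorem deRhamD_comp (K : Type*) [Field K] {n : ℕ} {N : Type*} [AddCommGroup N] [Module K N]
    (D : Fin n → Module.End K N) (hD : ∀ i j x, D i (D j x) = D j (D i x)) (p : ℕ)
    (w : FormIndex n p → N) : deRhamD K D (p + 1) (deRhamD K D p w) = 0 := by
  funext S
  rw [deRhamD_apply]
  simp only [deRhamD_apply, map_sum, map_smul, Finset.smul_sum, smul_smul]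
  rw [Finset.sum_sigma']
  refine Finset.sum_involution
    (fun x _ => ⟨⟨x.2.1, Finset.mem_of_mem_erase x.2.2⟩,
      ⟨x.1.1, Finset.mem_erase.2 ⟨(Finset.ne_of_mem_erase x.2.2).symm, x.1.2⟩⟩⟩) ?_ ?_ ?_ ?_
  · rintro ⟨⟨i, hi⟩, ⟨j, hj⟩⟩ -
    have hne : j ≠ i := Finset.ne_of_mem_erase hj
    have hjS : j ∈ S.1 := Finset.mem_of_mem_erase hj
    have hS : (S.erase j hjS).erase i (Finset.mem_erase.2 ⟨hne.symm, hi⟩) =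
        (S.erase i hi).erase j hj := Subtype.ext Finset.erase_right_comm
    dsimp only
    rw [hS, hD j i, ← add_smul]
    rcases lt_or_gt_of_ne hne with h | h
    · have := sign_swap K S.1 hjS h
      simp only [FormIndex.erase] at this ⊢
      rw [this, add_neg_cancel, zero_smul]
    · have := sign_swap K S.1 hi h
      simp only [FormIndex.erase] at this ⊢
      rw [this, neg_add_cancel, zero_smul]
  · rintro ⟨⟨i, hi⟩, ⟨j, hj⟩⟩ - - h
    have hne : j ≠ i := Finset.ne_of_mem_erase hj
    simp only [Sigma.mk.injEq, Subtype.mk.injEq] at h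
    exact hne h.1
  · intros
    exact Finset.mem_univ _
  · intros
    rfl

/-- The coboundaries of degree `p` of the de Rham complex. -/
noncomputable def deRhamB (K : Type*) [Field K] {n : ℕ} {N : Type*} [AddCommGroup N] [Module K N]
    (D : Fin n → Module.End K N) : (p : ℕ) → Submodule K (FormIndex n p → N)
  | 0 => ⊥
  | p + 1 => LinearMap.range (deRhamD K D p)

/-- The de Rham cohomology `H^p(D; N)` of a family of commuting operators `D` on `N`: cocycles
modulo coboundaries. -/
abbrev deRhamCohomology (K : Type*) [Field K] {n : ℕ} {N : Type*} [AddCommGroup N] [Module K N]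
    (D : Fin n → Module.End K N) (p : ℕ) : Type _ :=
  LinearMap.ker (deRhamD K D p) ⧸ (deRhamB K D p).submoduleOf (LinearMap.ker (deRhamD K D p))

/-! ### The action of the partial derivatives on `R_f` -/

/-- For a derivation `d` of `R`, the ring homomorphism `a ↦ a + d(a) ε` to the dual numbers over
`R_f`. -/
noncomputable def dualHom {K R : Type*} [Field K] [CommRing R] [Algebra K R]
    (d : Derivation K R R) (f : R) : R →+* DualNumber (Localization.Away f) where
  toFun a := TrivSqZeroExt.inl (algebraMap R (Localization.Away f) a) +
    TrivSqZeroExt.inr (algebraMap R (Localization.Away f) (d a))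
  map_one' := by ext <;> simp
  map_zero' := by ext <;> simp
  map_add' a b := by ext <;> simp [Algebra.smul_def]
  map_mul' a b := by
    ext
    · simp
    · simp only [TrivSqZeroExt.snd_add, TrivSqZeroExt.snd_mul, TrivSqZeroExt.fst_add,
        TrivSqZeroExt.fst_inl, TrivSqZeroExt.snd_inl, TrivSqZeroExt.fst_inr,
        TrivSqZeroExt.snd_inr, Derivation.leibniz, map_add, map_mul, smul_eq_mul,
        MulOpposite.smul_eq_mul_unop, MulOpposite.unop_op]
      ring

theorem isUnit_dualHom {K R : Type*} [Field K] [CommRing R] [Algebra K R]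
    (d : Derivation K R R) (f : R) : IsUnit (dualHom d f f) := by
  rw [TrivSqZeroExt.isUnit_iff_isUnit_fst]
  simpa [dualHom] using IsLocalization.Away.algebraMap_isUnit (S := Localization.Away f) f

/-- The extension of `dualHom` to `R_f`. -/
noncomputable def dualHomAway {K R : Type*} [Field K] [CommRing R] [Algebra K R]
    (d : Derivation K R R) (f : R) : Localization.Away f →+* DualNumber (Localization.Away f) :=
  IsLocalization.Away.lift f (isUnit_dualHom d f)

theorem dualHomAway_algebraMap {K R : Type*} [Field K] [CommRing R] [Algebra K R]
    (d : Derivation K R R) (f a : R) :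
    dualHomAway d f (algebraMap R (Localization.Away f) a) = dualHom d f a :=
  IsLocalization.Away.lift_eq f (isUnit_dualHom d f) a

theorem fst_dualHomAway {K R : Type*} [Field K] [CommRing R] [Algebra K R]
    (d : Derivation K R R) (f : R) (x : Localization.Away f) : (dualHomAway d f x).fst = x := by
  have h : ((TrivSqZeroExt.fstHom (Localization.Away f) (Localization.Away f)
      (Localization.Away f)).toRingHom.comp (dualHomAway d f)) = RingHom.id _ := by
    apply IsLocalization.ringHom_ext (Submonoid.powers f)
    ext a
    simp [dualHomAway_algebraMap, dualHom]
  exact congrArg (fun g => g x) h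

/-- The unique extension to `R_f` of a derivation `d` of `R` (the quotient rule), as the
`ε`-component of the ring homomorphism `x ↦ x + d(x) ε`. -/
noncomputable def awayDerivation {K R : Type*} [Field K] [CommRing R] [Algebra K R]
    (d : Derivation K R R) (f : R) :
    Derivation K (Localization.Away f) (Localization.Away f) :=
  Derivation.mk'
    { toFun := fun x => (dualHomAway d f x).snd
      map_add' := fun x y => by simp
      map_smul' := fun c x => by
        rw [Algebra.smul_def, IsScalarTower.algebraMap_apply K R (Localization.Away f), map_mul,
          TrivSqZeroExt.snd_mul, fst_dualHomAway, fst_dualHomAway, dualHomAway_algebraMap]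
        simp [dualHom, Algebra.smul_def, IsScalarTower.algebraMap_apply K R (Localization.Away f)] }
    (fun x y => by
      simp only [LinearMap.coe_mk, AddHom.coe_mk]
      rw [map_mul, TrivSqZeroExt.snd_mul, fst_dualHomAway, fst_dualHomAway]
      simp [mul_comm])

/-- `awayDerivation d f` extends `d`. -/
theorem awayDerivation_algebraMap {K R : Type*} [Field K] [CommRing R] [Algebra K R]
    (d : Derivation K R R) (f a : R) :
    awayDerivation d f (algebraMap R (Localization.Away f) a) =
      algebraMap R (Localization.Away f) (d a) := by
  change (dualHomAway d f (algebraMap R (Localization.Away f) a)).snd = _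
  rw [dualHomAway_algebraMap]
  change (TrivSqZeroExt.inl _ + TrivSqZeroExt.inr _ : DualNumber (Localization.Away f)).snd = _
  rw [TrivSqZeroExt.snd_add, TrivSqZeroExt.snd_inl, TrivSqZeroExt.snd_inr, zero_add]

/-- A derivation of `R_f` is determined by its values on `R`. -/
theorem away_derivation_ext {K R : Type*} [Field K] [CommRing R] [Algebra K R] (f : R)
    (d e : Derivation K (Localization.Away f) (Localization.Away f))
    (h : ∀ a : R, d (algebraMap R _ a) = e (algebraMap R _ a)) : d = e := by
  ext x
  obtain ⟨k, a, hx⟩ := IsLocalization.Away.surj f x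
  have hu : IsUnit (algebraMap R (Localization.Away f) f ^ k) :=
    IsLocalization.Away.algebraMap_pow_isUnit f k
  have h1 := congrArg d hx
  have h2 := congrArg e hx
  rw [← map_pow, Derivation.leibniz] at h1 h2
  rw [h, h, ← h2] at h1
  have h3 := add_left_cancel h1
  rw [smul_eq_mul, smul_eq_mul, map_pow] at h3
  exact hu.mul_left_cancel h3

/-! ### The local cohomology module `H^1_(f)(R)` -/

/-- The image of `R → R_f`, as a `K`-subspace. -/
noncomputable def awayRange (K : Type*) {R : Type*} [Field K] [CommRing R] [Algebra K R] (f : R) :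
    Submodule K (Localization.Away f) :=
  LinearMap.range (IsScalarTower.toAlgHom K R (Localization.Away f)).toLinearMap

/-- The first local cohomology module `H^1_(f)(R)`, that is, the first cohomology of the Čech
complex `0 → R → R_f → 0`, as a `K`-vector space. -/
abbrev H1 (K : Type*) {R : Type*} [Field K] [CommRing R] [Algebra K R] (f : R) : Type _ :=
  Localization.Away f ⧸ awayRange K f

theorem awayRange_le_comap {K R : Type*} [Field K] [CommRing R] [Algebra K R]
    (d : Derivation K R R) (f : R) :
    awayRange K f ≤ (awayRange K f).comap
      (awayDerivation d f : Localization.Away f →ₗ[K] Localization.Away f) := by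
  rintro _ ⟨a, rfl⟩
  exact ⟨d a, (awayDerivation_algebraMap d f a).symm⟩

/-- The action of a derivation of `R` on `H^1_(f)(R)`, induced from its action on `R_f`. -/
noncomputable def H1Derivation {K R : Type*} [Field K] [CommRing R] [Algebra K R]
    (d : Derivation K R R) (f : R) : Module.End K (H1 K f) :=
  Submodule.mapQ _ _ (awayDerivation d f : Localization.Away f →ₗ[K] Localization.Away f)
    (awayRange_le_comap d f)

/-- The operators `∂_1, …, ∂_n` of the Weyl algebra on `H^1_(f)(R)`, `R = K[X_1, …, X_n]`. -/
noncomputable def partialH1 {K : Type*} [Field K] {n : ℕ} (f : MvPolynomial (Fin n) K) :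
    Fin n → Module.End K (H1 K f) :=
  fun i => H1Derivation (MvPolynomial.pderiv i) f

/-- The operators `∂_i` on `H^1_(f)(R)` commute. -/
theorem partialH1_comm {K : Type*} [Field K] {n : ℕ} (f : MvPolynomial (Fin n) K) (i j : Fin n)
    (x : H1 K f) : partialH1 f i (partialH1 f j x) = partialH1 f j (partialH1 f i x) := by
  obtain ⟨x, rfl⟩ := Submodule.Quotient.mk_surjective _ x
  have h : ⁅awayDerivation (MvPolynomial.pderiv (R := K) i) f,
      awayDerivation (MvPolynomial.pderiv j) f⁆ = 0 := by
    apply away_derivation_ext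
    intro a
    have hc : ⁅MvPolynomial.pderiv (R := K) i, MvPolynomial.pderiv (R := K) j⁆ = 0 := by
      apply MvPolynomial.derivation_ext
      intro k
      rw [Derivation.commutator_apply, MvPolynomial.pderiv_X, MvPolynomial.pderiv_X]
      simp only [Pi.single_apply]
      split_ifs <;> simp
    have ha := congrArg
      (fun g : Derivation K (MvPolynomial (Fin n) K) (MvPolynomial (Fin n) K) => g a) hc
    rw [Derivation.commutator_apply] at ha
    simp only [awayDerivation_algebraMap, Derivation.commutator_apply]
    rw [← map_sub, ha]
    simp
  have hx := congrArg
    (fun g : Derivation K (Localization.Away f) (Localization.Away f) => g x) h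
  rw [Derivation.commutator_apply] at hx
  exact congrArg (Submodule.Quotient.mk (p := awayRange K f)) (sub_eq_zero.1 hx)

/-- The polynomial `X_1^2 + … + X_{n-1}^2 + X_n^m`; the variables are indexed from `0`. -/
noncomputable def exampleF (K : Type*) [Field K] (n m : ℕ) : MvPolynomial (Fin n) K :=
  ∑ i : Fin n, MvPolynomial.X i ^ (if (i : ℕ) + 1 = n then m else 2)

end DeRhamLocalCohomology

/-! In degree n - 1 a form is a vector field: cocycles become divergence-free fields, and
coboundaries become row divergences of antisymmetric matrices (`exactFields`). The question is which
divergence-free fields are not exact.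

Choose weights w_i with r_i w_i = d, so that f = ∑ X_i ^ r_i is homogeneous of weight d, and let E =
(w_i X_i) be the Euler field. The weight of a field g / f^k with g_i of weight e + w_i is λ = ∑ w_j
+ e - k d. Wedging with E is a Cartan homotopy for multiplication by λ, so a divergence-free field
with λ ≠ 0 is exact (`frac_mem_exactFields_of_weight_ne_zero`).

For λ = 0, induct on the pole order (`frac_mem_of_weight_zero`). A divergence-free g / f^k with k ≥
1 has f ∣ ∑ g_i ∂_i f. Euler's identity turns this into a syzygy of the ∂_i f, which are unit
multiples of powers of distinct variables, so the syzygy is a Koszul one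
(`exists_numerator_decomposition`). Up to exact fields and lower poles, only multiples X^α E / f^k
with all α_i < r_i - 1 remain. At pole order one the Koszul matrix has entries of weight w_i + w_j -
∑ w_l, which is negative when n ≠ 2, so it vanishes.

For the given f, weight zero reads ∑ w_j + wt α = k d, which forces n = 2k and m = 2(α_n + 1)
(`eq_of_weight_eq`): at most one field survives, and only for n and m even. -/

open MvPolynomial

namespace DeRhamLocalCohomology

/-! ### Fractions g / f^k in the local cohomology module -/

section Frac

variable {K : Type*} [Field K] {n : ℕ} (f : MvPolynomial (Fin n) K)

/-- The class of `g / f ^ k` in `H^1_(f)(R)`. -/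
noncomputable def frac (k : ℕ) : MvPolynomial (Fin n) K →ₗ[K] H1 K f :=
  (awayRange K f).mkQ ∘ₗ
    LinearMap.mulRight K (IsLocalization.Away.invSelf (S := Localization.Away f) f ^ k) ∘ₗ
    (IsScalarTower.toAlgHom K (MvPolynomial (Fin n) K) (Localization.Away f)).toLinearMap

theorem frac_apply (k : ℕ) (g : MvPolynomial (Fin n) K) :
    frac f k g = (awayRange K f).mkQ
      (algebraMap _ (Localization.Away f) g * IsLocalization.Away.invSelf f ^ k) := rfl

theorem frac_zero_left (g : MvPolynomial (Fin n) K) : frac f 0 g = 0 := by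
  rw [frac_apply, Submodule.mkQ_apply, Submodule.Quotient.mk_eq_zero]
  exact ⟨g, by simp⟩

theorem frac_succ_mul (k : ℕ) (g : MvPolynomial (Fin n) K) :
    frac f (k + 1) (f * g) = frac f k g := by
  rw [frac_apply, frac_apply]
  refine congrArg _ ?_
  rw [map_mul, pow_succ]
  linear_combination (algebraMap _ (Localization.Away f) g * IsLocalization.Away.invSelf f ^ k) *
    IsLocalization.Away.mul_invSelf (S := Localization.Away f) f

theorem frac_add_pow_mul (k l : ℕ) (g : MvPolynomial (Fin n) K) :
    frac f (k + l) (f ^ l * g) = frac f k g := by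
  induction l with
  | zero => simp
  | succ l ih => rw [← add_assoc, pow_succ', mul_assoc, frac_succ_mul, ih]

theorem frac_eq_zero_iff (hf : f ≠ 0) (k : ℕ) (g : MvPolynomial (Fin n) K) :
    frac f k g = 0 ↔ f ^ k ∣ g := by
  constructor
  · intro h
    rw [frac_apply, Submodule.mkQ_apply, Submodule.Quotient.mk_eq_zero] at h
    obtain ⟨b, hb⟩ := h
    have hb' : algebraMap _ (Localization.Away f) b =
      algebraMap _ (Localization.Away f) g * IsLocalization.Away.invSelf f ^ k := hb
    have h1 : algebraMap _ (Localization.Away f) (f ^ k * b) = algebraMap _ _ g := by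
      rw [map_mul, hb', map_pow]
      have h2 := congrArg (· ^ k)
        (IsLocalization.Away.mul_invSelf (S := Localization.Away f) f)
      simp only [mul_pow, one_pow] at h2
      linear_combination algebraMap _ (Localization.Away f) g * h2
    have h3 := IsLocalization.injective (Localization.Away f)
      (powers_le_nonZeroDivisors_of_noZeroDivisors hf) h1
    exact ⟨b, h3.symm⟩
  · rintro ⟨b, rfl⟩
    have := frac_add_pow_mul f 0 k b
    rwa [zero_add, frac_zero_left] at this

theorem exists_frac_eq (x : H1 K f) : ∃ k g, x = frac f k g := by
  obtain ⟨y, rfl⟩ := Submodule.mkQ_surjective _ x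
  obtain ⟨k, g, h⟩ := IsLocalization.Away.surj f y
  refine ⟨k, g, ?_⟩
  rw [frac_apply, ← h, mul_assoc, ← mul_pow, IsLocalization.Away.mul_invSelf, one_pow, mul_one]

/-- A finite family of classes has a common denominator. -/
theorem exists_frac_eq_family {ι : Type*} [Finite ι] (a : ι → H1 K f) :
    ∃ k, ∃ g : ι → MvPolynomial (Fin n) K, ∀ i, a i = frac f k (g i) := by
  have := Fintype.ofFinite ι
  choose k g h using fun i => exists_frac_eq f (a i)
  refine ⟨∑ i, k i, fun i => f ^ (∑ j, k j - k i) * g i, fun i => ?_⟩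
  have hk : k i ≤ ∑ j, k j := Finset.single_le_sum (fun _ _ => Nat.zero_le _) (Finset.mem_univ i)
  have := frac_add_pow_mul f (k i) (∑ j, k j - k i) (g i)
  rw [Nat.add_sub_cancel' hk] at this
  rw [this, h i]

theorem awayDerivation_invSelf_pow (i : Fin n) (k : ℕ) :
    awayDerivation (pderiv i) f (IsLocalization.Away.invSelf f ^ k) =
      -(k : Localization.Away f) * (algebraMap _ _ (pderiv i f) *
        IsLocalization.Away.invSelf f ^ (k + 1)) := by
  have h1 := IsLocalization.Away.mul_invSelf (S := Localization.Away f) f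
  have h2 := congrArg (awayDerivation (pderiv (R := K) i) f) h1
  rw [Derivation.leibniz, awayDerivation_algebraMap, Derivation.map_one_eq_zero, smul_eq_mul,
    smul_eq_mul] at h2
  set v := IsLocalization.Away.invSelf (S := Localization.Away f) f
  set F := algebraMap _ (Localization.Away f) f
  -- Differentiating f · f⁻¹ = 1 determines the derivative of f⁻¹.
  have h3 : awayDerivation (pderiv (R := K) i) f v = -(algebraMap _ _ (pderiv i f) * v ^ 2) := by
    linear_combination v * h2 - awayDerivation (pderiv (R := K) i) f v * h1
  rw [Derivation.leibniz_pow, h3]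
  rcases k with _ | k
  · simp
  · simp only [Nat.add_sub_cancel, smul_eq_mul, nsmul_eq_mul]
    ring

/-- The quotient rule. -/
theorem partialH1_frac (i : Fin n) (k : ℕ) (g : MvPolynomial (Fin n) K) :
    partialH1 f i (frac f k g) =
      frac f (k + 1) (f * pderiv i g - k * (g * pderiv i f)) := by
  rw [map_sub, frac_succ_mul]
  simp only [frac_apply]
  rw [← map_sub]
  change (awayRange K f).mkQ (awayDerivation (pderiv i) f _) = _
  rw [Derivation.leibniz, awayDerivation_algebraMap, awayDerivation_invSelf_pow]
  congr 1
  simp only [smul_eq_mul, map_mul, map_natCast]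
  ring

end Frac

/-! ### Divergence-free and exact fields -/

section Fields

variable {K : Type*} [Field K] {n : ℕ} {N : Type*} [AddCommGroup N] [Module K N]
  (D : Fin n → Module.End K N)

/-- The divergence `∑ D_i a_i` of a family `a`. -/
noncomputable def divergence : (Fin n → N) →ₗ[K] N :=
  ∑ i, D i ∘ₗ LinearMap.proj i

theorem divergence_apply (a : Fin n → N) : divergence D a = ∑ i, D i (a i) := by
  simp [divergence]

/-- The divergences of antisymmetric matrices. -/
def exactFields : Submodule K (Fin n → N) where
  carrier := {a | ∃ b : Fin n → Fin n → N, (∀ i j, b i j = -b j i) ∧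
    ∀ i, a i = ∑ j, D j (b i j)}
  zero_mem' := ⟨0, by simp, by simp⟩
  add_mem' := by
    rintro a a' ⟨b, hb, h⟩ ⟨b', hb', h'⟩
    refine ⟨b + b', fun i j => ?_, fun i => ?_⟩
    · simp only [Pi.add_apply]
      rw [hb i j, hb' i j]
      abel
    · simp [h, h', Finset.sum_add_distrib]
  smul_mem' := by
    rintro c a ⟨b, hb, h⟩
    refine ⟨c • b, fun i j => ?_, fun i => ?_⟩
    · simp only [Pi.smul_apply]
      rw [hb i j, smul_neg]
    · simp [h, Finset.smul_sum]

/-- The symmetric operators D_i D_j are paired with an antisymmetric matrix, so the double sum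
equals its own negative. -/
theorem divergence_of_mem_exactFields [CharZero K] (hD : ∀ i j x, D i (D j x) = D j (D i x))
    {a : Fin n → N} (ha : a ∈ exactFields D) : divergence D a = 0 := by
  obtain ⟨b, hb, h⟩ := ha
  have h1 : divergence D a = -divergence D a := by
    simp only [divergence_apply, h, map_sum]
    conv_lhs => rw [Finset.sum_comm]
    rw [← Finset.sum_neg_distrib]
    refine Finset.sum_congr rfl fun i _ => ?_
    rw [← Finset.sum_neg_distrib]
    refine Finset.sum_congr rfl fun j _ => ?_
    rw [hD, hb j i, map_neg, map_neg]
  have h2 : (2 : K) • divergence D a = 0 := by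
    rw [two_smul]
    nth_rewrite 1 [h1]
    exact neg_add_cancel _
  exact (smul_eq_zero.1 h2).resolve_left two_ne_zero

end Fields

/-! ### Weighted homogeneous components with integer weights -/

section Weights

variable {K : Type*} [Field K] {σ : Type*} {w : σ → ℤ}

/-- Integer weights allow negative degrees, so the shift by a cancels without side conditions; the
same holds for the shift by w_i under ∂_i below. -/
theorem weightedHomogeneousComponent_mul_of_left {p : MvPolynomial σ K} {a : ℤ}
    (hp : IsWeightedHomogeneous w p a) (b : ℤ) (q : MvPolynomial σ K) :
    weightedHomogeneousComponent w (a + b) (p * q) = p * weightedHomogeneousComponent w b q := by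
  induction q using MvPolynomial.induction_on' with
  | monomial α c =>
    have hm := isWeightedHomogeneous_monomial w α c rfl
    by_cases h : b = Finsupp.weight w α
    · rw [h, hm.weightedHomogeneousComponent_same, (hp.mul hm).weightedHomogeneousComponent_same]
    · rw [hm.weightedHomogeneousComponent_ne _ h,
        (hp.mul hm).weightedHomogeneousComponent_ne, mul_zero]
      simpa using h
  | add p q hp hq => rw [mul_add, map_add, map_add, mul_add, hp, hq]

theorem weightedHomogeneousComponent_pderiv (i : σ) (e : ℤ) (q : MvPolynomial σ K) :
    weightedHomogeneousComponent w e (pderiv i q) =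
      pderiv i (weightedHomogeneousComponent w (e + w i) q) := by
  induction q using MvPolynomial.induction_on' with
  | monomial α c =>
    have hm := isWeightedHomogeneous_monomial w α c rfl
    have hd := hm.pderiv (i := i) (sub_add_cancel _ (w i))
    by_cases h : e + w i = Finsupp.weight w α
    · rw [h, hm.weightedHomogeneousComponent_same]
      rw [← h, add_sub_cancel_right] at hd
      exact hd.weightedHomogeneousComponent_same
    · rw [hm.weightedHomogeneousComponent_ne _ h,
        hd.weightedHomogeneousComponent_ne, map_zero]
      intro h'
      exact h (by rw [h', sub_add_cancel])
  | add p q hp hq => rw [map_add, map_add, map_add, map_add, hp, hq]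

/-- Euler's identity for integer weights. -/
theorem sum_weight_X_mul_pderiv [Fintype σ] {p : MvPolynomial σ K} {e : ℤ}
    (hp : IsWeightedHomogeneous w p e) :
    ∑ i, (w i : MvPolynomial σ K) * (X i * pderiv i p) = (e : MvPolynomial σ K) * p := by
  conv_lhs => rw [p.as_sum]
  conv_rhs => rw [p.as_sum]
  simp only [map_sum, Finset.mul_sum]
  rw [Finset.sum_comm]
  refine Finset.sum_congr rfl fun α hα => ?_
  have h := hp (mem_support_iff.1 hα)
  rw [← h, Finsupp.weight_apply, Finsupp.sum_fintype _ _ (by simp), Int.cast_sum, Finset.sum_mul]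
  refine Finset.sum_congr rfl fun i _ => ?_
  rw [X_mul_pderiv_monomial]
  simp only [nsmul_eq_mul]
  push_cast
  ring

theorem isWeightedHomogeneous_eq_zero_of_neg (hw : ∀ i, 0 ≤ w i) {p : MvPolynomial σ K} {e : ℤ}
    (hp : IsWeightedHomogeneous w p e) (he : e < 0) : p = 0 := by
  by_contra h
  obtain ⟨α, hα⟩ := exists_coeff_ne_zero h
  have h1 := hp hα
  rw [Finsupp.weight_apply] at h1
  have h2 : 0 ≤ α.sum fun i c => c • w i :=
    Finset.sum_nonneg fun i _ => nsmul_nonneg (hw i) _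
  omega

end Weights

/-! ### Syzygies of powers of distinct variables -/

section Koszul

variable {K : Type*} [Field K] {σ : Type*} (r : σ → ℕ)

theorem mem_span_X_pow_iff (S : Finset σ) (p : MvPolynomial σ K) :
    p ∈ Ideal.span ((fun i => X i ^ r i) '' (S : Set σ) : Set (MvPolynomial σ K)) ↔
      ∀ α ∈ p.support, ∃ i ∈ S, r i ≤ α i := by
  have h : ((fun i => X i ^ r i) '' (S : Set σ) : Set (MvPolynomial σ K)) =
      (fun s => monomial s (1 : K)) '' ((fun i => Finsupp.single i (r i)) '' (S : Set σ)) := by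
    rw [Set.image_image]
    simp only [X_pow_eq_monomial]
  rw [h, mem_ideal_span_monomial_image]
  simp

theorem exists_eq_sum_mul_X_pow {S : Finset σ} {p : MvPolynomial σ K}
    (h : ∀ α ∈ p.support, ∃ i ∈ S, r i ≤ α i) :
    ∃ c : σ → MvPolynomial σ K, p = ∑ i ∈ S, c i * X i ^ r i := by
  rw [← mem_span_X_pow_iff] at h
  obtain ⟨c, hc⟩ := (Submodule.mem_span_image_finset_iff_exists_fun' _).1 h
  exact ⟨c, hc.symm⟩

/-- Exactness of the Koszul complex of powers of distinct variables in degree one. -/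
theorem exists_antisymm_of_sum_X_pow_mul_eq_zero (S : Finset σ) (u : σ → MvPolynomial σ K)
    (h : ∑ i ∈ S, X i ^ r i * u i = 0) :
    ∃ b : σ → σ → MvPolynomial σ K, (∀ i j, b i j = -b j i) ∧
      ∀ i ∈ S, u i = ∑ j ∈ S, b i j * X j ^ r j := by
  classical
  induction S using Finset.induction_on generalizing u with
  | empty => exact ⟨0, by simp, by simp⟩
  | insert a S ha ih =>
    rw [Finset.sum_insert ha] at h
    -- X_a ^ r_a is a nonzerodivisor modulo the monomial ideal of the other powers: multiplying by
    -- it leaves the exponents indexed by S unchanged.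
    obtain ⟨c, hc⟩ : ∃ c : σ → MvPolynomial σ K, u a = ∑ i ∈ S, c i * X i ^ r i := by
      apply exists_eq_sum_mul_X_pow
      have h1 : X a ^ r a * u a ∈
          Ideal.span ((fun i => X i ^ r i) '' (S : Set σ) : Set (MvPolynomial σ K)) := by
        rw [eq_neg_of_add_eq_zero_left h]
        refine neg_mem (sum_mem fun i hi => Ideal.mul_mem_right _ _ (Ideal.subset_span ?_))
        exact ⟨i, hi, rfl⟩
      rw [mem_span_X_pow_iff] at h1
      intro α hα
      obtain ⟨i, hi, hri⟩ := h1 (Finsupp.single a (r a) + α) (by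
        rw [mem_support_iff] at hα ⊢
        rwa [X_pow_eq_monomial, coeff_monomial_mul, one_mul])
      refine ⟨i, hi, ?_⟩
      have hne : a ≠ i := fun h => ha (h ▸ hi)
      simpa [Finsupp.single_apply, hne] using hri
    -- Substituting the expression for u_a leaves a relation supported on S alone.
    obtain ⟨b, hb, hu⟩ := ih (fun i => u i + X a ^ r a * c i) (by
      rw [← h, hc, Finset.mul_sum, ← Finset.sum_add_distrib]
      refine Finset.sum_congr rfl fun i _ => ?_
      ring)
    -- Border the matrix for S with the row c and the column -c.
    refine ⟨fun i j => if i = a then (if j = a then 0 else c j) else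
      if j = a then -c i else b i j, fun i j => ?_, fun i hi => ?_⟩
    · dsimp only
      split_ifs
      · simp
      · simp
      · simp
      · exact hb i j
    · rw [Finset.sum_insert ha]
      have hS : ∀ j ∈ S, j ≠ a := fun j hj h => ha (h ▸ hj)
      rcases Finset.mem_insert.1 hi with rfl | hi
      · simp only [if_true, zero_mul, zero_add]
        rw [hc]
        exact Finset.sum_congr rfl fun j hj => by rw [if_neg (hS j hj)]
      · simp only [if_neg (hS i hi), if_true]
        have : ∑ j ∈ S, (if j = a then -c i else b i j) * X j ^ r j =
            ∑ j ∈ S, b i j * X j ^ r j :=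
          Finset.sum_congr rfl fun j hj => by rw [if_neg (hS j hj)]
        rw [this, ← hu i hi]
        ring

theorem exists_eq_sum_monomial_add_sum_mul_X_pow [Fintype σ] (p : MvPolynomial σ K) :
    ∃ c : σ → MvPolynomial σ K,
      p = ∑ α ∈ p.support with ∀ i, α i < r i, monomial α (p.coeff α) + ∑ i, c i * X i ^ r i := by
  classical
  obtain ⟨c, hc⟩ := exists_eq_sum_mul_X_pow r (S := Finset.univ)
    (p := ∑ α ∈ p.support with ¬ ∀ i, α i < r i, monomial α (p.coeff α)) (by
      intro α hα
      obtain ⟨β, hβ, h⟩ := Finset.mem_biUnion.1 (support_sum hα)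
      have := Finset.mem_singleton.1 (support_monomial_subset h)
      subst this
      simpa using (Finset.mem_filter.1 hβ).2)
  refine ⟨c, ?_⟩
  rw [← hc, Finset.sum_filter_add_sum_filter_not]
  exact p.as_sum

end Koszul

/-! ### Weight decomposition and the Euler homotopy -/

section Graded

variable {K : Type*} [Field K] {n : ℕ} {f : MvPolynomial (Fin n) K} {w : Fin n → ℤ} {d : ℤ}

theorem divergence_frac (f : MvPolynomial (Fin n) K) (k : ℕ) (g : Fin n → MvPolynomial (Fin n) K) :
    divergence (partialH1 f) (fun i => frac f k (g i)) =
      frac f (k + 1) (∑ i, (f * pderiv i (g i) - k * (g i * pderiv i f))) := by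
  rw [divergence_apply, map_sum]
  exact Finset.sum_congr rfl fun i _ => partialH1_frac f i k (g i)

theorem divergence_frac_eq_zero_iff (hf : f ≠ 0) (k : ℕ) (g : Fin n → MvPolynomial (Fin n) K) :
    divergence (partialH1 f) (fun i => frac f k (g i)) = 0 ↔
      f ^ (k + 1) ∣ ∑ i, (f * pderiv i (g i) - k * (g i * pderiv i f)) := by
  rw [divergence_frac, frac_eq_zero_iff f hf]

/-- The homogeneous components of a divergence free field are divergence free. -/
theorem divergence_frac_component (hf : f ≠ 0) (hfd : IsWeightedHomogeneous w f d) (k : ℕ)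
    (g : Fin n → MvPolynomial (Fin n) K)
    (hg : divergence (partialH1 f) (fun i => frac f k (g i)) = 0) (e : ℤ) :
    divergence (partialH1 f)
      (fun i => frac f k (weightedHomogeneousComponent w (e + w i) (g i))) = 0 := by
  rw [divergence_frac_eq_zero_iff hf] at hg ⊢
  obtain ⟨h, hh⟩ := hg
  -- Take the component of weight d + e on both sides of the divisibility relation; f^(k+1) accounts
  -- for (k+1) d of it.
  refine ⟨weightedHomogeneousComponent w (d + e - (k + 1) • d) h, ?_⟩
  rw [← weightedHomogeneousComponent_mul_of_left (hfd.pow (k + 1)), add_sub_cancel, ← hh, map_sum]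
  refine Finset.sum_congr rfl fun i _ => ?_
  have h1 : d + e = (d - w i) + (e + w i) := by ring
  rw [map_sub, weightedHomogeneousComponent_mul_of_left hfd, weightedHomogeneousComponent_pderiv,
    ← map_natCast (C (σ := Fin n) (R := K)) k, weightedHomogeneousComponent_C_mul,
    mul_comm (g i), h1,
    weightedHomogeneousComponent_mul_of_left (hfd.pderiv (sub_add_cancel d (w i))),
    mul_comm (pderiv i f)]

/-- One index e must serve every coordinate, the i-th entry of a piece having weight e + w_i; T
collects the shifts wt(β) - w_i over all the supports. -/
theorem exists_eq_sum_component (w : Fin n → ℤ) (g : Fin n → MvPolynomial (Fin n) K) :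
    ∃ T : Finset ℤ, ∀ i, g i = ∑ e ∈ T, weightedHomogeneousComponent w (e + w i) (g i) := by
  classical
  refine ⟨Finset.univ.biUnion fun i =>
    (g i).support.image fun α => Finsupp.weight w α - w i, fun i => ?_⟩
  ext β
  rw [coeff_sum]
  simp only [coeff_weightedHomogeneousComponent]
  by_cases h : coeff β (g i) = 0
  · simp [h]
  · rw [Finset.sum_eq_single (Finsupp.weight w β - w i)]
    · simp
    · intro e _ he
      rw [if_neg]
      intro h'
      exact he (by rw [h', add_sub_cancel_right])
    · intro h'
      refine absurd (Finset.mem_biUnion.2 ⟨i, Finset.mem_univ _, ?_⟩) h'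
      exact Finset.mem_image_of_mem _ (mem_support_iff.2 h)

theorem frac_intCast_mul (f : MvPolynomial (Fin n) K) (k : ℕ) (c : ℤ)
    (g : MvPolynomial (Fin n) K) : frac f k ((c : MvPolynomial (Fin n) K) * g) =
      (c : K) • frac f k g := by
  rw [← map_smul, smul_eq_C_mul, map_intCast]

/-- The divergence of a multiple of the Euler field. -/
theorem sum_partialH1_frac_weight_mul_X (hfd : IsWeightedHomogeneous w f d) (k : ℕ)
    {p : MvPolynomial (Fin n) K} {e : ℤ} (hp : IsWeightedHomogeneous w p e) :
    ∑ j, partialH1 f j (frac f k ((w j : MvPolynomial (Fin n) K) * (X j * p))) =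
      ((∑ j, w j + e - k * d : ℤ) : K) • frac f k p := by
  simp only [partialH1_frac]
  rw [← map_sum, ← frac_intCast_mul, ← frac_succ_mul f k]
  refine congrArg _ ?_
  have h1 := sum_weight_X_mul_pderiv hp
  have h2 := sum_weight_X_mul_pderiv hfd
  push_cast
  -- Prepare for Euler's identity for p and for f; the term ∑ w_j comes from differentiating the
  -- X_j.
  have h3 : f * (((∑ j, (w j : MvPolynomial (Fin n) K)) + e - k * d) * p) =
      ∑ j, ((w j : MvPolynomial (Fin n) K) * (f * p)) +
      f * (e * p) - k * p * (d * f) := by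
    rw [← Finset.sum_mul]
    ring
  rw [h3, ← h1, ← h2, Finset.mul_sum, Finset.mul_sum, ← Finset.sum_add_distrib,
    ← Finset.sum_sub_distrib]
  refine Finset.sum_congr rfl fun j _ => ?_
  rw [Derivation.leibniz, Derivation.leibniz, ← map_intCast (C (σ := Fin n) (R := K)) (w j),
    pderiv_C, pderiv_X_self]
  simp only [smul_eq_mul]
  ring

/-- This is div (X_i a) = X_i div a + a_i, with div a = 0. -/
theorem sum_partialH1_frac_X_mul (hf : f ≠ 0) (k : ℕ) (g : Fin n → MvPolynomial (Fin n) K)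
    (hg : divergence (partialH1 f) (fun i => frac f k (g i)) = 0) (i : Fin n) :
    ∑ j, partialH1 f j (frac f k (X i * g j)) = frac f k (g i) := by
  rw [divergence_frac_eq_zero_iff hf] at hg
  simp only [partialH1_frac]
  rw [← map_sum]
  have h1 : ∑ j, (f * pderiv j (X i * g j) -
      (k : MvPolynomial (Fin n) K) * (X i * g j * pderiv j f)) =
      X i * ∑ j, (f * pderiv j (g j) - k * (g j * pderiv j f)) + f * g i := by
    rw [Finset.mul_sum]
    have : f * g i = ∑ j, f * (g j * pderiv j (X i)) := by
      rw [Finset.sum_eq_single i]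
      · rw [pderiv_X_self, mul_one]
      · intro j _ hj
        rw [pderiv_X_of_ne hj.symm, mul_zero, mul_zero]
      · simp
    rw [this, ← Finset.sum_add_distrib]
    refine Finset.sum_congr rfl fun j _ => ?_
    rw [Derivation.leibniz]
    simp only [smul_eq_mul]
    ring
  rw [h1, map_add, frac_succ_mul, (frac_eq_zero_iff f hf _ _).2 (Dvd.dvd.mul_left hg _), zero_add]

/-- A divergence free homogeneous field of nonzero weight is exact. -/
theorem frac_mem_exactFields_of_weight_ne_zero [CharZero K] (hf : f ≠ 0)
    (hfd : IsWeightedHomogeneous w f d) (k : ℕ) (g : Fin n → MvPolynomial (Fin n) K) (e : ℤ)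
    (hgw : ∀ i, IsWeightedHomogeneous w (g i) (e + w i))
    (hg : divergence (partialH1 f) (fun i => frac f k (g i)) = 0)
    (he : ∑ j, w j + e - k * d ≠ 0) :
    (fun i => frac f k (g i)) ∈ exactFields (partialH1 f) := by
  set l : K := ((∑ j, w j + e - k * d : ℤ) : K) with hl
  have hl0 : l ≠ 0 := by
    rw [hl]
    exact_mod_cast he
  -- The matrix is the wedge of a with the Euler field, divided by λ. Row i has divergence (λ + w_i)
  -- a_i - w_i a_i before the division.
  refine ⟨fun i j => l⁻¹ • frac f k
    ((w j : MvPolynomial (Fin n) K) * (X j * g i) - (w i : MvPolynomial (Fin n) K) * (X i * g j)),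
    fun i j => ?_, fun i => ?_⟩
  · rw [← smul_neg, ← map_neg, neg_sub]
  · simp only [map_smul, map_sub]
    rw [← Finset.smul_sum, Finset.sum_sub_distrib, sum_partialH1_frac_weight_mul_X hfd k (hgw i)]
    simp only [frac_intCast_mul, map_smul]
    rw [← Finset.smul_sum, sum_partialH1_frac_X_mul hf k g hg, ← sub_smul, ← Int.cast_sub]
    have : (∑ j, w j + (e + w i) - k * d - w i : ℤ) = ∑ j, w j + e - k * d := by ring
    rw [this, ← hl, smul_smul, inv_mul_cancel₀ hl0, one_smul]

end Graded

/-! ### Syzygies and Jacobian ideal of ∑ X_i ^ r_i -/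

section Fermat

variable {K : Type*} [Field K] {n : ℕ}

/-- The polynomial `∑ X_i ^ r_i`. -/
noncomputable def fermat (K : Type*) [Field K] {n : ℕ} (r : Fin n → ℕ) : MvPolynomial (Fin n) K :=
  ∑ i, X i ^ r i

theorem pderiv_fermat (r : Fin n → ℕ) (i : Fin n) :
    pderiv i (fermat K r) = C (r i : K) * X i ^ (r i - 1) := by
  rw [fermat, map_sum, Finset.sum_eq_single i]
  · rw [Derivation.leibniz_pow, pderiv_X_self]
    simp
  · intro j _ hj
    rw [Derivation.leibniz_pow, pderiv_X_of_ne hj]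
    simp
  · simp

theorem fermat_ne_zero [CharZero K] [NeZero n] {r : Fin n → ℕ} (hr : ∀ i, 2 ≤ r i) :
    fermat K r ≠ 0 := by
  intro h
  have h1 := pderiv_fermat (K := K) r 0
  rw [h, map_zero] at h1
  have h2 : (r 0 : K) ≠ 0 := by
    have := hr 0
    exact_mod_cast (by omega : r 0 ≠ 0)
  exact mul_ne_zero (by simpa using h2) (pow_ne_zero _ (X_ne_zero _)) h1.symm

variable {r : Fin n → ℕ} {w : Fin n → ℤ} {d : ℤ}

theorem isWeightedHomogeneous_fermat (hwr : ∀ i, r i * w i = d) :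
    IsWeightedHomogeneous w (fermat K r) d := by
  refine IsWeightedHomogeneous.sum _ _ _ fun i _ => ?_
  have := (isWeightedHomogeneous_X K w i).pow (r i)
  rwa [nsmul_eq_mul, hwr] at this

/-- Up to the units r_i the partial derivatives are powers of distinct variables, so the Koszul
lemma applies; passing to components makes the matrix homogeneous. -/
theorem exists_antisymm_of_sum_mul_pderiv_fermat_eq_zero [CharZero K] (hr : ∀ i, 2 ≤ r i)
    (hwr : ∀ i, r i * w i = d) (e : ℤ)
    (u : Fin n → MvPolynomial (Fin n) K) (hu : ∀ i, IsWeightedHomogeneous w (u i) (e + w i))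
    (h : ∑ i, u i * pderiv i (fermat K r) = 0) :
    ∃ b : Fin n → Fin n → MvPolynomial (Fin n) K, (∀ i j, b i j = -b j i) ∧
      (∀ i j, IsWeightedHomogeneous w (b i j) (e + w i + w j - d)) ∧
      ∀ i, u i = ∑ j, b i j * pderiv j (fermat K r) := by
  have hr0 : ∀ i, (r i : K) ≠ 0 := fun i => by
    have := hr i
    exact_mod_cast (by omega : r i ≠ 0)
  obtain ⟨b, hb, hub⟩ := exists_antisymm_of_sum_X_pow_mul_eq_zero (fun i => r i - 1) Finset.univ
    (fun i => C (r i : K) * u i) (by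
      rw [← h]
      refine Finset.sum_congr rfl fun i _ => ?_
      rw [pderiv_fermat]
      ring)
  -- The factor 1/r_i undoes the rescaling of u_i, and 1/r_j turns X_j ^ (r_j - 1) into ∂_j f. Their
  -- product is symmetric, so antisymmetry survives.
  refine ⟨fun i j => weightedHomogeneousComponent w (e + w i + w j - d)
    (C ((r i : K)⁻¹ * (r j : K)⁻¹) * b i j), fun i j => ?_, fun i j => ?_, fun i => ?_⟩
  · dsimp only
    rw [hb i j, mul_neg, map_neg, mul_comm (r i : K)⁻¹]
    have : e + w i + w j - d = e + w j + w i - d := by ring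
    rw [this]
  · exact weightedHomogeneousComponent_isWeightedHomogeneous _ _
  · have h1 : u i = ∑ j, pderiv j (fermat K r) * (C ((r i : K)⁻¹ * (r j : K)⁻¹) * b i j) := by
      have h2 : u i = C ((r i : K)⁻¹) * (C (r i : K) * u i) := by
        rw [← mul_assoc, ← C_mul, inv_mul_cancel₀ (hr0 i), C_1, one_mul]
      rw [h2, hub i (Finset.mem_univ _), Finset.mul_sum]
      refine Finset.sum_congr rfl fun j _ => ?_
      rw [pderiv_fermat, C_mul]
      have h3 : C (r j : K) * C (σ := Fin n) (r j : K)⁻¹ = 1 := by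
        rw [← C_mul, mul_inv_cancel₀ (hr0 j), C_1]
      linear_combination (-C (r i : K)⁻¹ * b i j * X j ^ (r j - 1)) * h3
    conv_lhs => rw [← (hu i).weightedHomogeneousComponent_same, h1, map_sum]
    refine Finset.sum_congr rfl fun j _ => ?_
    have h4 : e + w i = (d - w j) + (e + w i + w j - d) := by ring
    rw [h4, weightedHomogeneousComponent_mul_of_left
      ((isWeightedHomogeneous_fermat hwr).pderiv (sub_add_cancel d (w j))), mul_comm]

/-- Homogeneous polynomials modulo the Jacobian ideal. -/
theorem exists_eq_sum_monomial_add_sum_mul_pderiv_fermat [CharZero K] (hr : ∀ i, 2 ≤ r i)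
    (hwr : ∀ i, r i * w i = d) (e : ℤ) (s : MvPolynomial (Fin n) K)
    (hs : IsWeightedHomogeneous w s e) :
    ∃ A : Finset (Fin n →₀ ℕ), (∀ α ∈ A, (∀ i, α i + 1 < r i) ∧ Finsupp.weight w α = e) ∧
      ∃ t : Fin n → MvPolynomial (Fin n) K,
        (∀ i, IsWeightedHomogeneous w (t i) (e + w i - d)) ∧
        s = ∑ α ∈ A, monomial α (s.coeff α) + ∑ i, t i * pderiv i (fermat K r) := by
  have hr0 : ∀ i, (r i : K) ≠ 0 := fun i => by
    have := hr i
    exact_mod_cast (by omega : r i ≠ 0)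
  obtain ⟨c, hc⟩ := exists_eq_sum_monomial_add_sum_mul_X_pow (fun i => r i - 1) s
  have hA : ∀ α ∈ s.support.filter (fun α => ∀ i, α i < r i - 1),
      (∀ i, α i + 1 < r i) ∧ Finsupp.weight w α = e := by
    intro α hα
    rw [Finset.mem_filter, mem_support_iff] at hα
    exact ⟨fun i => by have := hα.2 i; omega, hs hα.1⟩
  refine ⟨_, hA, fun i => weightedHomogeneousComponent w (e + w i - d)
    (C (r i : K)⁻¹ * c i), fun i => weightedHomogeneousComponent_isWeightedHomogeneous _ _, ?_⟩
  conv_lhs => rw [← hs.weightedHomogeneousComponent_same]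
  nth_rewrite 1 [hc]
  rw [map_add, map_sum, map_sum]
  congr 1
  · refine Finset.sum_congr (by congr) fun α hα => ?_
    exact (isWeightedHomogeneous_monomial w α _ (hA α hα).2).weightedHomogeneousComponent_same
  · refine Finset.sum_congr rfl fun j _ => ?_
    have h1 : c j * X j ^ (r j - 1) = pderiv j (fermat K r) * (C (r j : K)⁻¹ * c j) := by
      rw [pderiv_fermat]
      have h3 : C (r j : K) * C (σ := Fin n) (r j : K)⁻¹ = 1 := by
        rw [← C_mul, mul_inv_cancel₀ (hr0 j), C_1]
      linear_combination (-c j * X j ^ (r j - 1)) * h3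
    have h4 : e = (d - w j) + (e + w j - d) := by ring
    rw [h1]
    conv_lhs => rw [h4]
    rw [weightedHomogeneousComponent_mul_of_left
      ((isWeightedHomogeneous_fermat hwr).pderiv (sub_add_cancel d (w j))), mul_comm]

/-- The shape of the numerators of a homogeneous field whose pairing with the gradient of `f` is
divisible by `f`. -/
theorem exists_numerator_decomposition [CharZero K] (hr : ∀ i, 2 ≤ r i)
    (hwr : ∀ i, r i * w i = d) (e : ℤ) (g : Fin n → MvPolynomial (Fin n) K)
    (hg : ∀ i, IsWeightedHomogeneous w (g i) (e + w i)) (s : MvPolynomial (Fin n) K)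
    (h : ∑ i, g i * pderiv i (fermat K r) = fermat K r * s) :
    ∃ A : Finset (Fin n →₀ ℕ), (∀ α ∈ A, (∀ i, α i + 1 < r i) ∧ Finsupp.weight w α = e) ∧
      ∃ c : (Fin n →₀ ℕ) → K, ∃ b : Fin n → Fin n → MvPolynomial (Fin n) K,
      ∃ t : Fin n → MvPolynomial (Fin n) K,
        (∀ i j, b i j = -b j i) ∧
        (∀ i j, IsWeightedHomogeneous w (b i j) (e + w i + w j - d)) ∧
        (∀ i, IsWeightedHomogeneous w (t i) (e + w i - d)) ∧
        ∀ i, (d : MvPolynomial (Fin n) K) * g i =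
          (w i : MvPolynomial (Fin n) K) * (X i * ∑ α ∈ A, monomial α (c α)) +
          ∑ j, b i j * pderiv j (fermat K r) + fermat K r * ((d : MvPolynomial (Fin n) K) * t i) := by
  have hfd := isWeightedHomogeneous_fermat (K := K) hwr
  have hCw : ∀ c : ℤ, IsWeightedHomogeneous w (c : MvPolynomial (Fin n) K) 0 := fun c => by
    rw [← map_intCast (C (σ := Fin n) (R := K)) c]
    exact isWeightedHomogeneous_C w _
  obtain ⟨s, hs, h⟩ : ∃ s, IsWeightedHomogeneous w s e ∧
      ∑ i, g i * pderiv i (fermat K r) = fermat K r * s := by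
    refine ⟨weightedHomogeneousComponent w e s,
      weightedHomogeneousComponent_isWeightedHomogeneous _ _, ?_⟩
    rw [← weightedHomogeneousComponent_mul_of_left hfd, ← h]
    refine (IsWeightedHomogeneous.weightedHomogeneousComponent_same
      (IsWeightedHomogeneous.sum _ _ _ fun i _ => ?_)).symm
    have := (hg i).mul (hfd.pderiv (sub_add_cancel d (w i)))
    rwa [show e + w i + (d - w i) = d + e by ring] at this
  have heuler := sum_weight_X_mul_pderiv hfd
  -- By Euler's identity d f = ∑ w_i X_i ∂_i f, the field d g - s E pairs to zero with the gradient
  -- of f.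
  obtain ⟨b, hb, hbw, hbu⟩ := exists_antisymm_of_sum_mul_pderiv_fermat_eq_zero hr hwr e
    (fun i => (d : MvPolynomial (Fin n) K) * g i - (w i : MvPolynomial (Fin n) K) * (X i * s))
    (fun i => by
      have h1 := (hCw d).mul (hg i)
      have h2 := (hCw (w i)).mul ((isWeightedHomogeneous_X K w i).mul hs)
      rw [zero_add] at h1 h2
      rw [add_comm (w i)] at h2
      exact h1.sub h2)
    (by
      calc _ = (d : MvPolynomial (Fin n) K) * ∑ i, g i * pderiv i (fermat K r) -
            s * ∑ i, (w i : MvPolynomial (Fin n) K) * (X i * pderiv i (fermat K r)) := by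
            rw [Finset.mul_sum, Finset.mul_sum, ← Finset.sum_sub_distrib]
            refine Finset.sum_congr rfl fun i _ => ?_
            ring
        _ = 0 := by
            rw [h, heuler]
            ring)
  obtain ⟨A, hA, t, ht, hst⟩ :=
    exists_eq_sum_monomial_add_sum_mul_pderiv_fermat hr hwr e s hs
  -- The part ∑ t_j ∂_j f of s contributes w_i X_i ∑ t_j ∂_j f, which is an antisymmetric matrix
  -- applied to the gradient plus d f t_i, again by Euler's identity.
  refine ⟨A, hA, fun α => s.coeff α, fun i j => b i j +
    ((w i : MvPolynomial (Fin n) K) * (X i * t j) - (w j : MvPolynomial (Fin n) K) * (X j * t i)),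
    t, fun i j => ?_, fun i j => ?_, ht, fun i => ?_⟩
  · dsimp only
    rw [hb i j]
    ring
  · have h1 := (hCw (w i)).mul ((isWeightedHomogeneous_X K w i).mul (ht j))
    have h2 := (hCw (w j)).mul ((isWeightedHomogeneous_X K w j).mul (ht i))
    rw [show 0 + (w i + (e + w j - d)) = e + w i + w j - d by ring] at h1
    rw [show 0 + (w j + (e + w i - d)) = e + w i + w j - d by ring] at h2
    exact (hbw i j).add (h1.sub h2)
  · have h1 : ∑ j, (b i j + ((w i : MvPolynomial (Fin n) K) * (X i * t j) -
          (w j : MvPolynomial (Fin n) K) * (X j * t i))) * pderiv j (fermat K r) =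
        ∑ j, b i j * pderiv j (fermat K r) +
        (w i : MvPolynomial (Fin n) K) * X i * ∑ j, t j * pderiv j (fermat K r) -
        t i * ∑ j, (w j : MvPolynomial (Fin n) K) * (X j * pderiv j (fermat K r)) := by
      rw [Finset.mul_sum, Finset.mul_sum, ← Finset.sum_add_distrib, ← Finset.sum_sub_distrib]
      refine Finset.sum_congr rfl fun j _ => ?_
      ring
    rw [h1, heuler, ← hbu i]
    linear_combination ((w i : MvPolynomial (Fin n) K) * X i) * hst

end Fermat

/-! ### Fields of weight zero: reduction of the pole order -/

section Fermat

variable {K : Type*} [Field K] {n : ℕ} {r : Fin n → ℕ} {w : Fin n → ℤ} {d : ℤ}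

/-- The multiple `X ^ α / f ^ k` of the Euler field. -/
noncomputable def eulerField (f : MvPolynomial (Fin n) K) (w : Fin n → ℤ) (k : ℕ)
    (α : Fin n →₀ ℕ) : Fin n → H1 K f :=
  fun i => frac f k ((w i : MvPolynomial (Fin n) K) * (X i * monomial α 1))

theorem divergence_eulerField {f : MvPolynomial (Fin n) K} (hfd : IsWeightedHomogeneous w f d)
    {k : ℕ} {α : Fin n →₀ ℕ} (h : ∑ j, w j + Finsupp.weight w α = k * d) :
    divergence (partialH1 f) (eulerField f w k α) = 0 := by
  rw [divergence_apply]
  refine (sum_partialH1_frac_weight_mul_X hfd k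
    (isWeightedHomogeneous_monomial w α 1 rfl)).trans ?_
  rw [h, sub_self, Int.cast_zero, zero_smul]

theorem frac_weight_mul_X_mul_sum_monomial (f : MvPolynomial (Fin n) K) (k : ℕ)
    (A : Finset (Fin n →₀ ℕ)) (c : (Fin n →₀ ℕ) → K) :
    (fun i => frac f k ((w i : MvPolynomial (Fin n) K) * (X i * ∑ α ∈ A, monomial α (c α)))) =
      ∑ α ∈ A, c α • eulerField f w k α := by
  funext i
  simp only [Finset.mul_sum, map_sum, Finset.sum_apply, Pi.smul_apply, eulerField]
  refine Finset.sum_congr rfl fun α _ => ?_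
  rw [← map_smul]
  refine congrArg _ ?_
  rw [← mul_smul_comm, ← mul_smul_comm, smul_monomial, smul_eq_mul, mul_one]

/-- Terms `∑ b_ij ∂_j f / f ^ (k + 1)` with `b` antisymmetric can be replaced by terms with a pole
of smaller order. -/
theorem exists_mem_exactFields_sum_frac_mul_pderiv [CharZero K] (f : MvPolynomial (Fin n) K)
    {k : ℕ} (hk : k ≠ 0) (b : Fin n → Fin n → MvPolynomial (Fin n) K)
    (hb : ∀ i j, b i j = -b j i) :
    ∃ a ∈ exactFields (partialH1 f), ∀ i, frac f (k + 1) (∑ j, b i j * pderiv j f) =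
      (k : K)⁻¹ • (frac f k (∑ j, pderiv j (b i j)) - a i) := by
  refine ⟨fun i => ∑ j, partialH1 f j (frac f k (b i j)),
    ⟨fun i j => frac f k (b i j), fun i j => (congrArg _ (hb i j)).trans (map_neg _ _),
      fun i => rfl⟩, fun i => ?_⟩
  have hk0 : (k : K) ≠ 0 := by exact_mod_cast hk
  -- The quotient rule ∂_j (b_ij / f^k) = ∂_j b_ij / f^k - k b_ij ∂_j f / f^(k+1) is solved for its
  -- last term, which requires k ≠ 0.
  have h1 : ∑ j, partialH1 f j (frac f k (b i j)) = frac f k (∑ j, pderiv j (b i j)) -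
      (k : K) • frac f (k + 1) (∑ j, b i j * pderiv j f) := by
    rw [map_sum, map_sum, Finset.smul_sum, ← Finset.sum_sub_distrib]
    refine Finset.sum_congr rfl fun j _ => ?_
    rw [partialH1_frac, map_sub, frac_succ_mul, ← map_smul, smul_eq_C_mul, map_natCast]
  dsimp only
  rw [h1, sub_sub_cancel, smul_smul, inv_mul_cancel₀ hk0, one_smul]

variable [CharZero K] [NeZero n]

/-- Induction on the pole order: each step splits off Euler fields and an exact field, and the
remainder is divergence free with a pole of order one less. The target V is left arbitrary so as to
serve both the vanishing statement (V the exact fields) and the dimension bound (V enlarged by one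
Euler field). -/
theorem frac_mem_of_weight_zero (hr : ∀ i, 2 ≤ r i) (hwr : ∀ i, r i * w i = d)
    (hw : ∀ i, 0 ≤ w i) (hd : d ≠ 0) (hwW : ∀ i j, i ≠ j → w i + w j < ∑ l, w l)
    (V : Submodule K (Fin n → H1 K (fermat K r)))
    (hB : exactFields (partialH1 (fermat K r)) ≤ V)
    (hV : ∀ (k : ℕ) (α : Fin n →₀ ℕ), (∀ i, α i + 1 < r i) →
      ∑ j, w j + Finsupp.weight w α = k * d → eulerField (fermat K r) w k α ∈ V)
    (k : ℕ) (e : ℤ) (he : ∑ j, w j + e = k * d) (g : Fin n → MvPolynomial (Fin n) K)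
    (hgw : ∀ i, IsWeightedHomogeneous w (g i) (e + w i))
    (hg : divergence (partialH1 (fermat K r)) (fun i => frac (fermat K r) k (g i)) = 0) :
    (fun i => frac (fermat K r) k (g i)) ∈ V := by
  induction k generalizing e g with
  | zero =>
    simp only [frac_zero_left]
    exact V.zero_mem
  | succ k ih =>
    have hf0 : (fermat K r) ≠ 0 := fermat_ne_zero hr
    have hfd : IsWeightedHomogeneous w (fermat K r) d := isWeightedHomogeneous_fermat hwr
    have hdK : (d : K) ≠ 0 := by exact_mod_cast hd
    have hkK : ((k + 1 : ℕ) : K) ≠ 0 := by exact_mod_cast Nat.succ_ne_zero k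
    obtain ⟨h, hh⟩ := (divergence_frac_eq_zero_iff hf0 _ _).1 hg
    -- Solve f div g - (k+1) ∑ g_i ∂_i f = f^(k+2) h for ∑ g_i ∂_i f, which is then f times the
    -- displayed polynomial.
    obtain ⟨A, hA, c, b, t, hb, hbw, htw, hdec⟩ := exists_numerator_decomposition hr hwr e g hgw
      (C ((k + 1 : ℕ) : K)⁻¹ * (∑ i, pderiv i (g i) - (fermat K r) ^ (k + 1) * h)) (by
        rw [Finset.sum_sub_distrib, ← Finset.mul_sum, ← Finset.mul_sum] at hh
        have h1 : C ((k + 1 : ℕ) : K)⁻¹ * ((k + 1 : ℕ) : MvPolynomial (Fin n) K) = 1 := by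
          rw [← map_natCast (C (σ := Fin n) (R := K)), ← C_mul, inv_mul_cancel₀ hkK, C_1]
        linear_combination (-∑ i, g i * pderiv i (fermat K r)) * h1 - C ((k + 1 : ℕ) : K)⁻¹ * hh)
    have hgoal : ∀ a : Fin n → H1 K (fermat K r), (d : K) • a ∈ V → a ∈ V := fun a ha => by
      have := V.smul_mem (d : K)⁻¹ ha
      rwa [smul_smul, inv_mul_cancel₀ hdK, one_smul] at this
    have hEV : ∑ α ∈ A, c α • eulerField (fermat K r) w (k + 1) α ∈ V :=
      sum_mem fun α hα => V.smul_mem _ (hV _ _ (hA α hα).1 (by rw [(hA α hα).2, he]))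
    have hEdiv : divergence (partialH1 (fermat K r))
        (∑ α ∈ A, c α • eulerField (fermat K r) w (k + 1) α) = 0 := by
      rw [map_sum]
      refine Finset.sum_eq_zero fun α hα => ?_
      rw [map_smul, divergence_eulerField hfd (by rw [(hA α hα).2, he]), smul_zero]
    have hsplit : (d : K) • (fun i => frac (fermat K r) (k + 1) (g i)) =
        (∑ α ∈ A, c α • eulerField (fermat K r) w (k + 1) α) +
        (fun i => frac (fermat K r) (k + 1) (∑ j, b i j * pderiv j (fermat K r))) +
        fun i => frac (fermat K r) k ((d : MvPolynomial (Fin n) K) * t i) := by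
      rw [← frac_weight_mul_X_mul_sum_monomial]
      funext i
      simp only [Pi.smul_apply, Pi.add_apply]
      rw [← frac_intCast_mul, hdec i, map_add, map_add, frac_succ_mul]
    apply hgoal
    rcases eq_or_ne k 0 with rfl | hk
    -- At pole order one the quotient rule cannot remove b. But e = d - ∑ w_l, so b_ij has weight
    -- w_i + w_j - ∑ w_l < 0 off the diagonal.
    · have hb0 : ∀ i j, b i j = 0 := by
        intro i j
        rcases eq_or_ne i j with rfl | hij
        · have := hb i i
          exact self_eq_neg.1 this
        · refine isWeightedHomogeneous_eq_zero_of_neg hw (hbw i j) ?_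
          have := hwW i j hij
          push_cast at he
          linarith
      have h0 : (fun i => frac (fermat K r) (0 + 1) (∑ j, b i j * pderiv j (fermat K r))) = 0 := by
        funext i
        simp [hb0]
      have h1 : (fun i => frac (fermat K r) 0 ((d : MvPolynomial (Fin n) K) * t i)) = 0 := by
        funext i
        exact frac_zero_left (fermat K r) _
      rw [hsplit, h0, h1, add_zero, add_zero]
      exact hEV
    · obtain ⟨a, ha, hab⟩ := exists_mem_exactFields_sum_frac_mul_pderiv (fermat K r) hk b hb
      set g' : Fin n → MvPolynomial (Fin n) K := fun i =>
        C (k : K)⁻¹ * ∑ j, pderiv j (b i j) + (d : MvPolynomial (Fin n) K) * t i with hg'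
      have hsplit' : (d : K) • (fun i => frac (fermat K r) (k + 1) (g i)) =
          (∑ α ∈ A, c α • eulerField (fermat K r) w (k + 1) α) - (k : K)⁻¹ • a +
            fun i => frac (fermat K r) k (g' i) := by
        rw [hsplit]
        funext i
        simp only [Pi.smul_apply, Pi.add_apply, Pi.sub_apply, hg']
        rw [hab i, map_add, ← smul_eq_C_mul, map_smul, smul_sub]
        abel
      -- The remainder is divergence free because everything split off is.
      have hdiv' : divergence (partialH1 (fermat K r))
          (fun i => frac (fermat K r) k (g' i)) = 0 := by
        have := congrArg (divergence (partialH1 (fermat K r))) hsplit'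
        rw [map_smul, hg, smul_zero, map_add, map_sub, hEdiv, map_smul,
          divergence_of_mem_exactFields _ (partialH1_comm (fermat K r)) ha, smul_zero, sub_zero,
          zero_add] at this
        exact this.symm
      rw [hsplit']
      refine V.add_mem (V.sub_mem hEV (V.smul_mem _ (hB ha))) (ih (e - d) ?_ g' ?_ hdiv')
      · push_cast at he
        linarith
      · intro i
        refine IsWeightedHomogeneous.add ?_ ?_
        · refine IsWeightedHomogeneous.C_mul ?_ _
          refine IsWeightedHomogeneous.sum _ _ _ fun j _ => (hbw i j).pderiv ?_
          ring
        · rw [← map_intCast (C (σ := Fin n) (R := K)) d]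
          refine IsWeightedHomogeneous.C_mul ?_ _
          have := htw i
          rwa [show e + w i - d = e - d + w i by ring] at this

/-- If the sum of all weights exceeds that of any two, the divergence free fields on `H^1_(f)(R)`,
`f = ∑ X_i ^ r_i`, are spanned by exact fields and Euler fields of weight zero. -/
theorem mem_of_divergence_eq_zero (hr : ∀ i, 2 ≤ r i) (hwr : ∀ i, r i * w i = d)
    (hw : ∀ i, 0 ≤ w i) (hd : d ≠ 0) (hwW : ∀ i j, i ≠ j → w i + w j < ∑ l, w l)
    (V : Submodule K (Fin n → H1 K (fermat K r)))
    (hB : exactFields (partialH1 (fermat K r)) ≤ V)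
    (hV : ∀ (k : ℕ) (α : Fin n →₀ ℕ), (∀ i, α i + 1 < r i) →
      ∑ j, w j + Finsupp.weight w α = k * d → eulerField (fermat K r) w k α ∈ V)
    (a : Fin n → H1 K (fermat K r)) (ha : divergence (partialH1 (fermat K r)) a = 0) : a ∈ V := by
  have hfd : IsWeightedHomogeneous w (fermat K r) d := isWeightedHomogeneous_fermat hwr
  obtain ⟨k, g, hg⟩ := exists_frac_eq_family _ a
  obtain rfl : a = fun i => frac _ k (g i) := funext hg
  obtain ⟨T, hT⟩ := exists_eq_sum_component w g
  have h1 : (fun i => frac (fermat K r) k (g i)) =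
      ∑ e ∈ T, fun i => frac (fermat K r) k (weightedHomogeneousComponent w (e + w i) (g i)) := by
    funext i
    conv_lhs => rw [hT i]
    rw [map_sum, Finset.sum_apply]
  rw [h1]
  refine sum_mem fun e _ => ?_
  have hdiv := divergence_frac_component (fermat_ne_zero hr) hfd k g ha e
  by_cases he : ∑ j, w j + e = k * d
  · exact frac_mem_of_weight_zero hr hwr hw hd hwW V hB hV k e he _
      (fun i => weightedHomogeneousComponent_isWeightedHomogeneous _ _) hdiv
  · exact hB (frac_mem_exactFields_of_weight_ne_zero (fermat_ne_zero hr) hfd k _ e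
      (fun i => weightedHomogeneousComponent_isWeightedHomogeneous _ _) hdiv (sub_ne_zero.2 he))

end Fermat

/-! ### Forms of degree n - 1 as vector fields -/

section Translation

variable {K : Type*} [Field K] {N : Type*} [AddCommGroup N] [Module K N]

/-- The index `univ \ {i}`. -/
def FormIndex.compl {q : ℕ} (i : Fin (q + 1)) : FormIndex (q + 1) q :=
  FormIndex.erase ⟨Finset.univ, by simp⟩ i (Finset.mem_univ i)

theorem FormIndex.exists_eq_compl {q : ℕ} (S : FormIndex (q + 1) q) : ∃ i, S = compl i := by
  have h : S.1ᶜ.card = 1 := by rw [Finset.card_compl, S.2, Fintype.card_fin]; omega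
  obtain ⟨i, hi⟩ := Finset.card_eq_one.1 h
  refine ⟨i, Subtype.ext ?_⟩
  have h1 : (compl i).1 = Finset.univ \ S.1ᶜ := by
    rw [hi, Finset.sdiff_singleton_eq_erase]
    rfl
  rw [h1]
  simp

/-- The field with components `± w_(univ \ {i})`. -/
noncomputable def toField (K : Type*) [Field K] {N : Type*} [AddCommGroup N] [Module K N] (q : ℕ) :
    (FormIndex (q + 1) q → N) →ₗ[K] (Fin (q + 1) → N) :=
  LinearMap.pi fun i => ((-1 : K) ^ (Finset.univ.filter (fun j => j < i)).card) •
    LinearMap.proj (FormIndex.compl i)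

theorem toField_apply {q : ℕ} (u : FormIndex (q + 1) q → N) (i : Fin (q + 1)) :
    toField K q u i =
      ((-1 : K) ^ (Finset.univ.filter (fun j => j < i)).card) • u (FormIndex.compl i) := rfl

theorem toField_injective (q : ℕ) : Function.Injective (toField K (N := N) q) := by
  intro u v h
  funext S
  obtain ⟨i, rfl⟩ := S.exists_eq_compl
  have := congrFun h i
  rw [toField_apply, toField_apply] at this
  exact smul_right_injective N (pow_ne_zero _ (neg_ne_zero.2 one_ne_zero)) this

theorem toField_surjective (q : ℕ) : Function.Surjective (toField K (N := N) q) := by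
  intro a
  choose s hs using fun S : FormIndex (q + 1) q => S.exists_eq_compl
  refine ⟨fun S => ((-1 : K) ^ (Finset.univ.filter (fun j => j < s S)).card) • a (s S), ?_⟩
  funext i
  have hi : s (FormIndex.compl i) = i := by
    by_contra hne
    have h1 := congrArg Subtype.val (hs (FormIndex.compl i))
    have h2 : s (FormIndex.compl i) ∈ (FormIndex.compl i).1 :=
      Finset.mem_erase.2 ⟨hne, Finset.mem_univ _⟩
    rw [h1] at h2
    exact Finset.notMem_erase _ _ h2
  rw [toField_apply, hi, smul_smul, ← mul_pow, neg_one_mul, neg_neg, one_pow, one_smul]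

/-- The full index set is the only subset with q + 1 elements, and its coefficient is the divergence
of the associated field. -/
theorem deRhamD_eq_zero_iff {q : ℕ} (D : Fin (q + 1) → Module.End K N)
    (u : FormIndex (q + 1) q → N) :
    deRhamD K D q u = 0 ↔ divergence D (toField K q u) = 0 := by
  have h : deRhamD K D q u ⟨Finset.univ, by simp⟩ = divergence D (toField K q u) := by
    rw [deRhamD_apply, divergence_apply]
    simp only [toField_apply, map_smul]
    refine Fintype.sum_equiv (Equiv.subtypeUnivEquiv fun i => Finset.mem_univ i) _ _ fun i => rfl
  rw [← h]
  constructor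
  · intro h'
    rw [h']
    rfl
  · intro h'
    funext S
    have hS : S = ⟨Finset.univ, by simp⟩ :=
      Subtype.ext ((Finset.card_eq_iff_eq_univ _).1 (by rw [S.2, Fintype.card_fin]))
    rw [hS, h']
    rfl

/-- A symmetric matrix with values off the diagonal defines a form in codimension two. -/
theorem exists_formIndex_eq {M : Type*} {q : ℕ} (U : Fin (q + 2) → Fin (q + 2) → M)
    (hU : ∀ i j, i ≠ j → U i j = U j i) :
    ∃ u : FormIndex (q + 2) q → M, ∀ i j (hij : j ∈ (FormIndex.compl i).1),
      u ((FormIndex.compl i).erase j hij) = U i j := by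
  have hex : ∀ T : FormIndex (q + 2) q, ∃ i j, i ≠ j ∧ T.1ᶜ = {i, j} := by
    intro T
    apply Finset.card_eq_two.1
    rw [Finset.card_compl, T.2, Fintype.card_fin]
    omega
  choose s t hst hT using hex
  refine ⟨fun T => U (s T) (t T), fun i j hij => ?_⟩
  have hne : j ≠ i := Finset.ne_of_mem_erase hij
  set T := (FormIndex.compl i).erase j hij with hTdef
  have h1 : T.1ᶜ = {i, j} := by
    ext l
    rw [hTdef]
    simp only [FormIndex.erase, FormIndex.compl, Finset.mem_compl, Finset.mem_erase,
      Finset.mem_univ, Finset.mem_insert, Finset.mem_singleton]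
    tauto
  rw [hT T] at h1
  have hs : s T ∈ ({i, j} : Finset _) := h1 ▸ Finset.mem_insert_self _ _
  have ht : t T ∈ ({i, j} : Finset _) :=
    h1 ▸ Finset.mem_insert_of_mem (Finset.mem_singleton_self _)
  have hn := hst T
  rw [Finset.mem_insert, Finset.mem_singleton] at hs ht
  dsimp only
  rcases hs with hs | hs <;> rcases ht with ht | ht
  · exact absurd (hs.trans ht.symm) hn
  · rw [hs, ht]
  · rw [hs, ht, hU j i hne]
  · exact absurd (hs.trans ht.symm) hn

theorem mem_deRhamB_of_toField_mem [CharZero K] {q : ℕ} (D : Fin (q + 1) → Module.End K N)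
    (u : FormIndex (q + 1) q → N) (h : toField K q u ∈ exactFields D) : u ∈ deRhamB K D q := by
  obtain ⟨b, hb, hu⟩ := h
  rcases q with _ | q
  -- In one variable there are no forms of degree -1: the coboundaries are zero, and so is an
  -- antisymmetric 1 × 1 matrix.
  · have hb0 : b 0 0 = 0 := by
      have h1 : (2 : K) • b 0 0 = 0 := by
        rw [two_smul]
        nth_rewrite 1 [hb 0 0]
        exact neg_add_cancel _
      exact (smul_eq_zero.1 h1).resolve_left two_ne_zero
    have h0 : toField K 0 u = 0 := by
      funext i
      rw [hu i, Fin.fin_one_eq_zero i]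
      simp [hb0]
    have : u = 0 := toField_injective (K := K) 0 (h0.trans (map_zero _).symm)
    rw [this]
    exact Submodule.zero_mem _
  -- The signs of the two successive removals change by -1 when i and j are swapped (`sign_swap`),
  -- so the signed antisymmetric matrix is symmetric and defines a form on complements of pairs.
  · obtain ⟨v, hv⟩ := exists_formIndex_eq (fun i j =>
      ((-1 : K) ^ (Finset.univ.filter (fun k => k < i)).card *
        (-1 : K) ^ ((Finset.univ.erase i).filter (fun k => k < j)).card) • b i j) (by
      intro i j hij
      rw [hb i j, smul_neg, ← neg_smul]
      congr 1
      rcases lt_or_gt_of_ne hij with h | h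
      · rw [sign_swap K Finset.univ (Finset.mem_univ i) h, neg_neg]
      · rw [sign_swap K Finset.univ (Finset.mem_univ j) h])
    refine ⟨v, toField_injective (K := K) (q + 1) ?_⟩
    funext i
    rw [hu i, toField_apply, deRhamD_apply, Finset.smul_sum]
    have hbii : b i i = 0 := by
      have h1 : (2 : K) • b i i = 0 := by
        rw [two_smul]
        nth_rewrite 1 [hb i i]
        exact neg_add_cancel _
      exact (smul_eq_zero.1 h1).resolve_left two_ne_zero
    rw [← Finset.sum_erase (a := i) Finset.univ (by rw [hbii, map_zero])]
    rw [← Finset.sum_coe_sort (Finset.univ.erase i)]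
    refine Fintype.sum_congr _ _ fun j => ?_
    rw [hv i j.1 j.2, map_smul, smul_smul, smul_smul]
    have h2 : ∀ l : ℕ, (-1 : K) ^ l * (-1 : K) ^ l = 1 := fun l => by
      rw [← mul_pow, neg_one_mul, neg_neg, one_pow]
    have h3 : (-1 : K) ^ (Finset.univ.filter (fun k => k < i)).card *
        (-1 : K) ^ ((FormIndex.compl i).1.filter (fun k => k < j.1)).card *
        ((-1 : K) ^ (Finset.univ.filter (fun k => k < i)).card *
        (-1 : K) ^ ((Finset.univ.erase i).filter (fun k => k < j.1)).card) = 1 := by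
      have h4 := h2 (Finset.univ.filter (fun k => k < i)).card
      have h5 := h2 ((Finset.univ.erase i).filter (fun k => k < j.1)).card
      change _ * (-1 : K) ^ ((Finset.univ.erase i).filter (fun k => k < j.1)).card * _ = _
      linear_combination (-1 : K) ^ ((Finset.univ.erase i).filter (fun k => k < j.1)).card *
        (-1 : K) ^ ((Finset.univ.erase i).filter (fun k => k < j.1)).card * h4 + h5
    exact ((congrArg (· • D j.1 (b i j.1)) h3).trans (one_smul _ _))

end Translation

/-! ### From fields to cohomology -/

section Cohomology

variable {K : Type*} [Field K] [CharZero K] {q : ℕ} {N : Type*} [AddCommGroup N] [Module K N]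
  {D : Fin (q + 1) → Module.End K N}

theorem subsingleton_deRhamCohomology_of_divergence
    (h : ∀ a, divergence D a = 0 → a ∈ exactFields D) :
    Subsingleton (deRhamCohomology K D q) := by
  rw [Submodule.Quotient.subsingleton_iff, eq_top_iff]
  rintro ⟨u, hu⟩ -
  exact mem_deRhamB_of_toField_mem D u (h _ ((deRhamD_eq_zero_iff D u).1 hu))

theorem rank_deRhamCohomology_le_one_of_divergence (v : Fin (q + 1) → N) (hv : divergence D v = 0)
    (h : ∀ a, divergence D a = 0 → a ∈ exactFields D ⊔ Submodule.span K {v}) :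
    Module.rank K (deRhamCohomology K D q) ≤ 1 := by
  obtain ⟨u₀, rfl⟩ := toField_surjective (K := K) q v
  rw [rank_le_one_iff]
  refine ⟨Submodule.Quotient.mk ⟨u₀, (deRhamD_eq_zero_iff D u₀).2 hv⟩, fun x => ?_⟩
  obtain ⟨⟨u, hu⟩, rfl⟩ := Submodule.Quotient.mk_surjective _ x
  obtain ⟨a, ha, b, hb, hab⟩ := Submodule.mem_sup.1 (h _ ((deRhamD_eq_zero_iff D u).1 hu))
  obtain ⟨c, rfl⟩ := Submodule.mem_span_singleton.1 hb
  refine ⟨c, ?_⟩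
  rw [eq_comm, ← Submodule.Quotient.mk_smul, Submodule.Quotient.eq]
  refine mem_deRhamB_of_toField_mem D (u - c • u₀) ?_
  rw [map_sub, map_smul, ← hab, add_sub_cancel_right]
  exact ha

end Cohomology

/-! ### The weights of X_1^2 + … + X_{n-1}^2 + X_n^m -/

section Example

/-- The exponents of `X_1 ^ 2 + … + X_{n-1} ^ 2 + X_n ^ m`. -/
def exampleExponent (n m : ℕ) (i : Fin n) : ℕ := if (i : ℕ) + 1 = n then m else 2

/-- Weights for which `X_1 ^ 2 + … + X_{n-1} ^ 2 + X_n ^ m` is homogeneous of weight `2 m`. -/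
def exampleWeight (n m : ℕ) (i : Fin n) : ℤ := if (i : ℕ) + 1 = n then 2 else m

variable {q m : ℕ}

theorem sum_exampleWeight : ∑ i, exampleWeight (q + 1) m i = m * q + 2 := by
  rw [Fin.sum_univ_castSucc]
  have : ∀ i : Fin q, exampleWeight (q + 1) m i.castSucc = m := fun i => by
    rw [exampleWeight, if_neg]
    have := i.2
    simp only [Fin.val_castSucc]
    omega
  simp only [this]
  simp [exampleWeight, mul_comm]

theorem exampleExponent_mul_exampleWeight (n : ℕ) (i : Fin n) :
    exampleExponent n m i * exampleWeight n m i = 2 * m := by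
  rw [exampleExponent, exampleWeight]
  split_ifs
  · ring
  · push_cast
    ring

/-- For n = 2 the two weights would sum exactly to the total; for n = 1 there is no pair i ≠ j. -/
theorem exampleWeight_add_lt (hm : 2 ≤ m) (hq : q ≠ 1) (i j : Fin (q + 1)) (hij : i ≠ j) :
    exampleWeight (q + 1) m i + exampleWeight (q + 1) m j <
      ∑ l, exampleWeight (q + 1) m l := by
  have h1 : (i : ℕ) ≠ j := fun h => hij (Fin.ext h)
  have hi := i.2
  have hj := j.2
  have hq2 : (2 : ℤ) ≤ q := by
    have : 2 ≤ q := by omega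
    exact_mod_cast this
  have hm2 : (2 : ℤ) ≤ m := by exact_mod_cast hm
  have h2 : (m : ℤ) * 2 ≤ m * q := mul_le_mul_of_nonneg_left hq2 (by omega)
  rw [sum_exampleWeight, exampleWeight, exampleWeight]
  split_ifs <;> omega

/-- The only Euler field of weight zero. -/
theorem eq_of_weight_eq {k : ℕ} {α : Fin (q + 1) →₀ ℕ}
    (hα : ∀ i, α i + 1 < exampleExponent (q + 1) m i)
    (h : ∑ i, exampleWeight (q + 1) m i + Finsupp.weight (exampleWeight (q + 1) m) α =
      k * (2 * m)) :
    2 * k = q + 1 ∧ 2 * (α (Fin.last q) + 1) = m ∧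
      α = Finsupp.single (Fin.last q) (α (Fin.last q)) := by
  have h0 : ∀ i : Fin (q + 1), i ≠ Fin.last q → α i = 0 := by
    intro i hi
    have h1 := hα i
    rw [exampleExponent, if_neg] at h1
    · omega
    · intro h2
      exact hi (Fin.ext (by simpa using h2))
  have hs : α = Finsupp.single (Fin.last q) (α (Fin.last q)) := by
    ext i
    by_cases hi : i = Fin.last q
    · rw [hi, Finsupp.single_eq_same]
    · rw [h0 i hi, Finsupp.single_eq_of_ne hi]
  have hl := hα (Fin.last q)
  generalize α (Fin.last q) = a at *
  rw [exampleExponent, if_pos (by simp)] at hl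
  rw [sum_exampleWeight, hs, Finsupp.weight_single, exampleWeight, if_pos (by simp),
    nsmul_eq_mul] at h
  have hm : (0 : ℤ) < m := by omega
  -- With a the exponent of the last variable, 0 < 2(a + 1) < 2m leaves 2k - q = 1 as the only
  -- possibility.
  have h2 : (m : ℤ) * (2 * k - q) = 2 * (a + 1) := by linarith
  have h3 : (0 : ℤ) < 2 * k - q := by
    by_contra h'
    have := mul_nonpos_of_nonneg_of_nonpos hm.le (not_lt.1 h')
    omega
  have h4 : (2 * k - q : ℤ) < 2 := by
    by_contra h'
    have := mul_le_mul_of_nonneg_left (not_lt.1 h') hm.le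
    omega
  have h5 : (2 * k - q : ℤ) = 1 := by omega
  rw [h5] at h2
  exact ⟨by omega, by omega, hs⟩

variable (K : Type*) [Field K] [CharZero K]

theorem mem_of_divergence_exampleF_eq_zero (hm : 2 ≤ m) (hq : q ≠ 1)
    (V : Submodule K (Fin (q + 1) → H1 K (exampleF K (q + 1) m)))
    (hB : exactFields (partialH1 (exampleF K (q + 1) m)) ≤ V)
    (hV : ∀ (k a : ℕ), 2 * k = q + 1 → 2 * (a + 1) = m →
      eulerField (exampleF K (q + 1) m) (exampleWeight (q + 1) m) k
        (Finsupp.single (Fin.last q) a) ∈ V)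
    (a : Fin (q + 1) → H1 K (exampleF K (q + 1) m))
    (ha : divergence (partialH1 (exampleF K (q + 1) m)) a = 0) : a ∈ V := by
  -- `exampleF` unfolds to `fermat` with these exponents.
  refine mem_of_divergence_eq_zero (r := exampleExponent (q + 1) m)
    (w := exampleWeight (q + 1) m) (d := 2 * m) (fun i => ?_)
    (exampleExponent_mul_exampleWeight (q + 1)) (fun i => ?_) (by omega)
    (exampleWeight_add_lt hm hq) V hB (fun k α hα h => ?_) a ha
  · rw [exampleExponent]
    split_ifs <;> omega
  · rw [exampleWeight]
    split_ifs <;> omega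
  · obtain ⟨h1, h2, h3⟩ := eq_of_weight_eq hα h
    rw [h3]
    exact hV _ _ h1 h2

theorem subsingleton_deRhamCohomology_exampleF (hm : 2 ≤ m) (hq : q ≠ 1)
    (h : Odd m ∨ Odd (q + 1)) :
    Subsingleton (deRhamCohomology K (partialH1 (exampleF K (q + 1) m)) q) := by
  refine subsingleton_deRhamCohomology_of_divergence
    (mem_of_divergence_exampleF_eq_zero K hm hq _ le_rfl fun k a hk ha => ?_)
  rcases h with ⟨l, h⟩ | ⟨l, h⟩ <;> omega

theorem rank_deRhamCohomology_exampleF_le_one (hm : 2 ≤ m) (hq : q ≠ 1) (hme : Even m)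
    (hqe : Even (q + 1)) :
    Module.rank K (deRhamCohomology K (partialH1 (exampleF K (q + 1) m)) q) ≤ 1 := by
  obtain ⟨k, hk⟩ := hqe
  obtain ⟨a, ha⟩ : ∃ a, m = 2 * (a + 1) := by
    obtain ⟨l, hl⟩ := hme
    exact ⟨l - 1, by omega⟩
  refine rank_deRhamCohomology_le_one_of_divergence
    (eulerField (exampleF K (q + 1) m) (exampleWeight (q + 1) m) k
      (Finsupp.single (Fin.last q) a)) ?_
    (mem_of_divergence_exampleF_eq_zero K hm hq _ le_sup_left fun k' a' hk' ha' => ?_)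
  · refine divergence_eulerField (d := 2 * m)
      (isWeightedHomogeneous_fermat (exampleExponent_mul_exampleWeight (q + 1))) ?_
    rw [sum_exampleWeight, Finsupp.weight_single, exampleWeight, if_pos (by simp), nsmul_eq_mul]
    have h1 : (q : ℤ) = k + k - 1 := by omega
    rw [h1, ha]
    push_cast
    ring
  · obtain rfl : k' = k := by omega
    obtain rfl : a' = a := by omega
    exact Submodule.mem_sup_right (Submodule.mem_span_singleton_self _)

end Example

end DeRhamLocalCohomology

theorem mainTheorem4 (K : Type*) [Field K] [CharZero K] (n m : ℕ) (hn : 1 ≤ n) (hn2 : n ≠ 2)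
    (hm : 2 ≤ m) :
    (Odd m → Subsingleton (DeRhamLocalCohomology.deRhamCohomology K
      (DeRhamLocalCohomology.partialH1 (DeRhamLocalCohomology.exampleF K n m)) (n - 1))) ∧
    (Even m → Odd n → Subsingleton (DeRhamLocalCohomology.deRhamCohomology K
      (DeRhamLocalCohomology.partialH1 (DeRhamLocalCohomology.exampleF K n m)) (n - 1))) ∧
    (Even m → Even n → Module.rank K (DeRhamLocalCohomology.deRhamCohomology K
      (DeRhamLocalCohomology.partialH1 (DeRhamLocalCohomology.exampleF K n m)) (n - 1)) ≤ 1) := by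
  obtain ⟨q, rfl⟩ : ∃ q, n = q + 1 := ⟨n - 1, by omega⟩
  have hq : q ≠ 1 := by omega
  exact ⟨fun h => DeRhamLocalCohomology.subsingleton_deRhamCohomology_exampleF K hm hq (Or.inl h),
    fun _ h => DeRhamLocalCohomology.subsingleton_deRhamCohomology_exampleF K hm hq (Or.inr h),
    fun h h' => DeRhamLocalCohomology.rank_deRhamCohomology_exampleF_le_one K hm hq h h'⟩
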